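/- Let $N\ge 1$, let $f\in S_2(\Gamma_0(N))$ be a newform (a normalized eigenform of all Hecke operators, orthogonal to the oldforms), and let $f_1=f,f_2,\dots,f_r$ be its distinct Galois conjugates, $\vec f=(f_1,\dots,f_r)^{tr}$. For $\tau=x+iy\in\mathfrak H$ put $$\vec{\mathcal E}(\tau)=\Big(-2\pi i\int_\tau^{i\infty}f_1(z)\,dz,\ \dots,\ -2\pi i\int_\tau^{i\infty}f_r(z)\,dz\Big)^{tr},$$ and let $\Lambda\subset\mathbb C^r$ be the period lattice, i.e. the group of all vectors $-2\pi i\int_c\vec f(z)\,dz$, where $c$ runs through the integral homology $H_1(X_0(N),\mathbb Z)$. Let $\omega,\omega'\in\mathbb C^{r\times r}$, with $\omega$ invertible, be period matrices, i.e. $\Lambda=\omega\mathbb Z^r+\omega'\mathbb Z^r$, chosen such that $\Omega=\omega^{-1}\omega'$ lies in the Siegel upper half-space ($\Omega^{tr}=\Omega$ and $\operatorname{Im}\Omega$ is positive definite). Let $\eta\in\mathbb C^{r\times r}$ (the quasi-period matrix; the result holds for any matrix $\eta$) and $\alpha,\beta\in\mathbb R^r$. For $u\in\mathbb C^r$ define,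 with $e(x)=\exp(2\pi i x)$, $$\theta(u;\Omega)=\sum_{m\in\mathbb Z^r}e\Big((m+\alpha)^{tr}(u+\beta)+\tfrac12(m+\alpha)^{tr}\Omega(m+\alpha)\Big),\qquad \sigma(u)=\exp\Big(\tfrac12u^{tr}\omega^{-1}\eta u\Big)\,\theta(\omega^{-1}u;\Omega),$$ $$\zeta(u)=\nabla_u\log\sigma(u)\ \text{(a row vector)},\qquad \widehat\zeta(u)=\zeta(u)-\tfrac12u^{tr}\big(\omega^{-1}\eta+\eta^{tr}\omega^{-tr}\big)+2\pi i\,\operatorname{Im}(\omega^{-1}u)^{tr}\operatorname{Im}(\Omega)^{-1}\omega^{-1}.$$ Then the integrals and series above converge, $\sigma$ is holomorphic on $\mathbb C^r$, and $\widehat{\mathfrak Z}(\tau)=\widehat\zeta(\vec{\mathcal E}(\tau))\in\mathbb C^{1\times r}$ is defined for all $\tau\in\mathfrak H$ with $\sigma(\vec{\mathcal E}(\tau))\neq0$. The set of these $\tau$ is stable under $\Gamma_0(N)$, and on it $\widehat{\mathfrak Z}$ is $\Gamma_0(N)$-invariant, smooth, and annihilated by the hyperbolic Laplacian $\Delta_0=-y^2\big(\frac{\partial^2}{\partial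 x^2}+\frac{\partial^2}{\partial y^2}\big)$. Moreover, the matrix $$P=\frac1{2i}\big(\overline\omega\,\omega'^{tr}-\overline{\omega'}\,\omega^{tr}\big)$$ is (Hermitian) positive definite, and on the same set $$\xi_0\widehat{\mathfrak Z}(\tau)=4\pi^2\,\vec f(\tau)^{tr}P^{-1},\qquad\text{where } \xi_0 G=2i\,\overline{\frac{\partial G}{\partial\overline\tau}}\ \text{ is applied to each component.}$$ -/

import Mathlib

open UpperHalfPlane hiding I
open Complex CongruenceSubgroup MeasureTheory Topology
open scoped UpperHalfPlane MatrixGroups ComplexConjugate Matrix ComplexOrder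

namespace Kleinian

noncomputable section

/-! ### Weight two newforms and their Galois conjugates -/

/-- The space `S₂(Γ₀(N))` of cusp forms of weight two for `Γ₀(N)`. -/
abbrev S2 (N : ℕ) : Type := CuspForm (Gamma0 N : Subgroup (GL (Fin 2) ℝ)) 2

/-- The coefficient `a_n` of `q ^ n`, `q = exp (2πiτ)`, in the Fourier expansion at `i∞`. -/
def fourierCoeff {N : ℕ} (f : S2 N) (n : ℕ) : ℂ :=
  (qExpansion 1 (f : ℍ → ℂ)).coeff n

/-- The weight two Hecke operator at a prime `p` for level `N` and trivial character:
`(T_p f)(τ) = p⁻¹ ∑_{b mod p} f((τ + b) / p) + p f(pτ)`, where the last summand is absent if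
`p ∣ N`. -/
def heckeT (N p : ℕ) (f : ℍ → ℂ) (τ : ℍ) : ℂ :=
  (p : ℂ)⁻¹ * ∑ b ∈ Finset.range p, f (ofComplex (((τ : ℂ) + b) / p)) +
    (if p ∣ N then 0 else (p : ℂ) * f (ofComplex ((p : ℂ) * τ)))

/-- The weight two Petersson inner product over `Γ₀(N) \ ℍ`. If `SL₂(ℤ)` is the disjoint union of
the left cosets `g Γ₀(N)`, the translates `g⁻¹ 𝒟` of the standard fundamental domain `𝒟` make up a
fundamental domain of `Γ₀(N)`. The measure is `dx dy / y²`. -/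
def peterssonInner (N : ℕ) (f g : ℍ → ℂ) : ℂ :=
  ∑ᶠ q : SL(2, ℤ) ⧸ Gamma0 N, ∫ z in ModularGroup.fd, petersson 2 f g (q.out⁻¹ • z)

/-- The generators `g(dτ)` of the space of oldforms of level `N`: here `g ∈ S₂(Γ₀(M))` for a proper
divisor `M` of `N`, and `d` divides `N / M`. -/
def IsOldGenerator (N : ℕ) (h : ℍ → ℂ) : Prop :=
  ∃ M d : ℕ, M ≠ N ∧ d * M ∣ N ∧ ∃ g : S2 M, h = fun τ : ℍ ↦ g (ofComplex ((d : ℂ) * τ))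

/-- Newforms: normalized eigenforms of all Hecke operators which are orthogonal to the space of
oldforms. -/
structure IsNewform {N : ℕ} (f : S2 N) : Prop where
  normalized : fourierCoeff f 1 = 1
  eigenform : ∀ p : ℕ, p.Prime → ∃ c : ℂ, heckeT N p f = fun τ ↦ c * f τ
  orthogonal_old : ∀ h : ℍ → ℂ, IsOldGenerator N h → peterssonInner N h f = 0

/-- The field generated over `ℚ` by the Fourier coefficients of `f`. -/
abbrev coeffField {N : ℕ} (f : S2 N) : IntermediateField ℚ ℂ :=
  IntermediateField.adjoin ℚ (Set.range (fourierCoeff f))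

/-- `g` is a Galois conjugate of `f`: the Fourier coefficients of `g` are the images of those of
`f` under some embedding of the coefficient field of `f` into `ℂ`. -/
def IsGaloisConjugate {N : ℕ} (f g : S2 N) : Prop :=
  ∃ s : coeffField f →ₐ[ℚ] ℂ, ∀ n : ℕ, fourierCoeff g n =
    s ⟨fourierCoeff f n, IntermediateField.subset_adjoin ℚ _ (Set.mem_range_self n)⟩

/-- `F` lists the Galois conjugates of `f`, each of them once, and begins with `f` itself. -/
structure IsGaloisOrbit {N r : ℕ} [NeZero r] (f : S2 N) (F : Fin r → S2 N) : Prop where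
  first : F 0 = f
  injective : Function.Injective F
  range_eq : Set.range F = {g | IsGaloisConjugate f g}

/-! ### Eichler integrals and the period lattice -/

/-- The integrand of `∫_τ^{i∞} f(z) dz` along the vertical ray `z = τ + it`, `t > 0`. -/
def eichlerIntegrand {N : ℕ} (f : S2 N) (τ : ℍ) (t : ℝ) : ℂ :=
  f (ofComplex ((τ : ℂ) + t * I)) * I

/-- The vector of Eichler integrals `-2πi ∫_τ^{i∞} f_j(z) dz`. -/
def eichlerIntegral {N r : ℕ} (F : Fin r → S2 N) (τ : ℍ) : Fin r → ℂ :=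
  fun j ↦ -2 * Real.pi * I * ∫ t in Set.Ioi (0 : ℝ), eichlerIntegrand (F j) τ t

/-- `c` restricted to `[0, 1]` is a continuously differentiable path in `ℍ` that becomes a closed
path in the modular curve `Γ₀(N) \ ℍ`. -/
def IsClosedModularPath (N : ℕ) (c : ℝ → ℂ) : Prop :=
  ContDiff ℝ 1 c ∧ (∀ t ∈ Set.Icc (0 : ℝ) 1, 0 < (c t).im) ∧
    ∃ γ ∈ Gamma0 N, γ • ofComplex (c 0) = ofComplex (c 1)

/-- The vector of the periods `-2πi ∫_c f_j(z) dz`. -/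
def pathPeriod {N r : ℕ} (F : Fin r → S2 N) (c : ℝ → ℂ) : Fin r → ℂ :=
  fun j ↦ -2 * Real.pi * I * ∫ t in (0 : ℝ)..1, F j (ofComplex (c t)) * deriv c t

/-- The period lattice: the group of periods `-2πi ∫_c (f_1, …, f_r)(z) dz` over the integral
homology of the modular curve. Every homology class of the compact curve `X₀(N)` is represented
by closed paths that avoid cusps and elliptic points, and small loops around these have period
zero, so that closed paths in `Γ₀(N) \ ℍ` with a lift to `ℍ` give all periods. -/
def periodLattice {N r : ℕ} (F : Fin r → S2 N) : AddSubgroup (Fin r → ℂ) :=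
  AddSubgroup.closure {v | ∃ c : ℝ → ℂ, IsClosedModularPath N c ∧ v = pathPeriod F c}

/-- The set `{ω m + ω' n : m, n ∈ ℤ^g}`. -/
def latticeOf {g : ℕ} (ω ω' : Matrix (Fin g) (Fin g) ℂ) : Set (Fin g → ℂ) :=
  {v | ∃ m n : Fin g → ℤ, v = ω *ᵥ (fun i ↦ (m i : ℂ)) + ω' *ᵥ (fun i ↦ (n i : ℂ))}

/-! ### Theta functions and Kleinian functions -/

/-- The entrywise imaginary part of a matrix. -/
def imMat {g : ℕ} (A : Matrix (Fin g) (Fin g) ℂ) : Matrix (Fin g) (Fin g) ℝ := A.map Complex.im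

/-- The Siegel upper half-space of genus `g`. -/
def siegelUpperHalfSpace (g : ℕ) : Set (Matrix (Fin g) (Fin g) ℂ) :=
  {Ω | Ωᵀ = Ω ∧ (imMat Ω).PosDef}

/-- `e(x) = exp (2πix)`. -/
def e (x : ℂ) : ℂ := cexp (2 * Real.pi * I * x)

/-- The summand of the Riemann theta series with characteristic `(α, β)` at `m ∈ ℤ^g`. -/
def thetaTerm {g : ℕ} (α β : Fin g → ℝ) (u : Fin g → ℂ) (Ω : Matrix (Fin g) (Fin g) ℂ)
    (m : Fin g → ℤ) : ℂ :=
  let a : Fin g → ℂ := fun i ↦ (m i : ℂ) + (α i : ℂ)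
  e (a ⬝ᵥ (u + fun i ↦ (β i : ℂ)) + 1 / 2 * (a ⬝ᵥ (Ω *ᵥ a)))

/-- The Riemann theta function with characteristic `(α, β)`. -/
def theta {g : ℕ} (α β : Fin g → ℝ) (u : Fin g → ℂ) (Ω : Matrix (Fin g) (Fin g) ℂ) : ℂ :=
  ∑' m : Fin g → ℤ, thetaTerm α β u Ω m

/-- The Kleinian `σ`-function
`exp (½ uᵗʳ ω⁻¹ η u) θ(ω⁻¹ u; ω⁻¹ ω')` with characteristic `(α, β)`. -/
def sigma {g : ℕ} (ω ω' η : Matrix (Fin g) (Fin g) ℂ) (α β : Fin g → ℝ) (u : Fin g → ℂ) : ℂ :=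
  cexp (1 / 2 * (u ⬝ᵥ ((ω⁻¹ * η) *ᵥ u))) * theta α β (ω⁻¹ *ᵥ u) (ω⁻¹ * ω')

/-- The Kleinian `ζ`-function `∇ log σ`, as the vector of the logarithmic partial derivatives
`∂_i σ / σ`. -/
def zeta {g : ℕ} (ω ω' η : Matrix (Fin g) (Fin g) ℂ) (α β : Fin g → ℝ) (u : Fin g → ℂ) :
    Fin g → ℂ :=
  fun i ↦ fderiv ℂ (sigma ω ω' η α β) u (Pi.single i 1) / sigma ω ω' η α β u

/-- The completed Kleinian `ζ`-function
`ζ(u) - ½ uᵗʳ (ω⁻¹ η + ηᵗʳ ω⁻ᵗʳ) + 2πi Im(ω⁻¹ u)ᵗʳ Im(ω⁻¹ ω')⁻¹ ω⁻¹` (a row vector). -/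
def zetaHat {g : ℕ} (ω ω' η : Matrix (Fin g) (Fin g) ℂ) (α β : Fin g → ℝ) (u : Fin g → ℂ) :
    Fin g → ℂ :=
  zeta ω ω' η α β u
    - (1 / 2 : ℂ) • (u ᵥ* (ω⁻¹ * η + ηᵀ * (ω⁻¹)ᵀ))
    + (2 * Real.pi * I) •
      ((fun i ↦ (((ω⁻¹ *ᵥ u) i).im : ℂ)) ᵥ* ((imMat (ω⁻¹ * ω'))⁻¹.map Complex.ofReal * ω⁻¹))

/-- The matrix `P = (1 / 2i) (ω̄ ω'ᵗʳ - ω̄' ωᵗʳ)`. -/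
def periodP {g : ℕ} (ω ω' : Matrix (Fin g) (Fin g) ℂ) : Matrix (Fin g) (Fin g) ℂ :=
  (1 / (2 * I) : ℂ) • (ω.map conj * ω'ᵀ - ω'.map conj * ωᵀ)

/-! ### Differential operators on the upper half-plane -/

/-- `∂G/∂x` for a function `G` of `z = x + iy`. -/
def partialX (G : ℂ → ℂ) (z : ℂ) : ℂ := fderiv ℝ G z 1

/-- `∂G/∂y` for a function `G` of `z = x + iy`. -/
def partialY (G : ℂ → ℂ) (z : ℂ) : ℂ := fderiv ℝ G z I

/-- The hyperbolic Laplacian of weight `k`,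
`Δ_k = -y² (∂²/∂x² + ∂²/∂y²) + iky (∂/∂x + i ∂/∂y)`. -/
def hyperbolicLaplacian (k : ℤ) (G : ℍ → ℂ) (τ : ℍ) : ℂ :=
  -(τ.im : ℂ) ^ 2 * (partialX (partialX (G ∘ ofComplex)) τ + partialY (partialY (G ∘ ofComplex)) τ)
    + I * k * τ.im * (partialX (G ∘ ofComplex) τ + I * partialY (G ∘ ofComplex) τ)

/-- The Wirtinger derivative `∂G/∂τ̄ = ½ (∂G/∂x + i ∂G/∂y)`. -/
def dbar (G : ℍ → ℂ) (τ : ℍ) : ℂ :=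
  1 / 2 * (partialX (G ∘ ofComplex) τ + I * partialY (G ∘ ofComplex) τ)

/-- The operator `ξ_k G = 2i y^k conj(∂G/∂τ̄)`. -/
def xi (k : ℤ) (G : ℍ → ℂ) (τ : ℍ) : ℂ :=
  2 * I * (τ.im : ℂ) ^ k * conj (dbar G τ)

end

end Kleinian

open Kleinian

namespace Kleinian

/-! ### Convergence of theta series -/

/-! Put v = ω⁻¹u. The exponential in σ contributes ½ uᵗʳ(ω⁻¹η + (ω⁻¹η)ᵗʳ) to ζ, which is exactly
what ζ̂ subtracts; so η disappears and ζ̂(u) = (∇ log θ)(v) ω⁻¹ + 2πi Im(v)ᵗʳ Im(Ω)⁻¹ ω⁻¹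
(`zetaHat_apply`).

Invariance: the Eichler vector is a primitive of 2πi(f₁, …, f_r), so its change under γ ∈ Γ₀(N) is,
up to sign, the period of a path from τ to γτ (`eichlerIntegral_smul_sub_mem`). Then v moves by some
m + Ωn. Quasi-periodicity of θ changes ∇ log θ by -2πi nᵗʳ, while Im v grows by Im(Ω)n, and the two
changes cancel (`zetaHat_add_lattice`).

Harmonicity and ξ₀: since 2πi Im v = π(v - v̄), each component of ζ̂ along the Eichler integrals is
H + K̄ with H and K holomorphic, K being a linear combination of Eichler integrals
(`exists_zetaHat_eq_add_conj`). Such a sum is harmonic, and its ∂/∂τ̄ is the conjugate of K′, a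
combination of the f_j. The coefficients are those of P⁻¹ because P = ω̄ Im(Ω) ωᵗʳ (`periodP_eq`),
which also shows that P is positive definite.

The analytic input is that theta series may be differentiated termwise twice
(`hasFDerivAt_weightedTheta`), and that a cusp form decays exponentially at i∞. -/

theorem summable_pi_prod {ι : Type*} {h : ι → ℝ} (h0 : ∀ i, 0 ≤ h i) (hs : Summable h) :
    ∀ g : ℕ, ∀ f : Fin g → ι → ℝ, (∀ i x, f i x = h x) →
      Summable fun m : Fin g → ι ↦ ∏ i, f i (m i)
  | 0, _, _ => (hasSum_fintype _).summable
  | g + 1, f, hf => by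
    have ih := summable_pi_prod h0 hs g (fun i ↦ f i.succ) (fun i x ↦ hf _ x)
    have := hs.mul_of_nonneg ih h0 (fun m ↦ Finset.prod_nonneg fun i _ ↦ by
      rw [hf]; exact h0 _)
    rw [← (Fin.consEquiv fun _ ↦ ι).summable_iff]
    refine this.congr fun x ↦ ?_
    simp [Fin.prod_univ_succ, Fin.consEquiv, hf]

theorem summable_exp_neg_abs_int : Summable fun m : ℤ ↦ Real.exp (-|(m : ℝ)|) := by
  have := Real.summable_exp_neg_nat
  refine Summable.of_nat_of_neg ?_ ?_ <;> simpa using this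

/-- In each coordinate the square beats the linear term with an extra -|k| to spare, so the series
is dominated by a product of geometric series. -/
theorem summable_exp_linear_sub_sq (g : ℕ) (α : Fin g → ℝ) (A : ℝ) {B : ℝ} (hB : 0 < B) :
    Summable fun m : Fin g → ℤ ↦
      Real.exp (∑ i, (A * |(m i : ℝ) + α i| - B * ((m i : ℝ) + α i) ^ 2)) := by
  have key : ∀ i, ∀ k : ℤ, A * |(k : ℝ) + α i| - B * ((k : ℝ) + α i) ^ 2 ≤
      ((A + 1) ^ 2 / (4 * B) + |α i|) + -|(k : ℝ)| := by
    intro i k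
    have h1 : |(k : ℝ)| ≤ |(k : ℝ) + α i| + |α i| := by
      have := abs_sub ((k : ℝ) + α i) (α i)
      simpa using this
    -- The bound is the maximum of (A + 1)x - Bx²; the extra slope 1 pays for -|k|.
    have h2 : (A + 1) * |(k : ℝ) + α i| - B * |(k : ℝ) + α i| ^ 2 ≤ (A + 1) ^ 2 / (4 * B) := by
      rw [le_div_iff₀ (by positivity)]
      nlinarith [sq_nonneg ((A + 1) - 2 * B * |(k : ℝ) + α i|)]
    rw [sq_abs] at h2
    linarith
  have h := (summable_pi_prod (fun _ ↦ (Real.exp_pos _).le) summable_exp_neg_abs_int g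
    (fun _ m ↦ Real.exp (-|(m : ℝ)|)) (fun _ _ ↦ rfl)).mul_left
      (Real.exp (∑ i, ((A + 1) ^ 2 / (4 * B) + |α i|)))
  refine Summable.of_nonneg_of_le (fun _ ↦ (Real.exp_pos _).le) (fun m ↦ ?_) h
  rw [← Real.exp_sum, ← Real.exp_add, ← Finset.sum_add_distrib]
  exact Real.exp_le_exp.mpr (Finset.sum_le_sum fun i _ ↦ key i (m i))

/-- By homogeneity it suffices to take the minimum of the form on the unit sphere. The norm is the
sup norm, so ∑ aᵢ² ≤ g‖a‖² and the minimum is divided by g. The sphere is empty only for g = 0. -/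
theorem exists_pos_mul_sum_sq_le {g : ℕ} {Y : Matrix (Fin g) (Fin g) ℝ} (hY : Y.PosDef) :
    ∃ c : ℝ, 0 < c ∧ ∀ a : Fin g → ℝ, c * ∑ i, a i ^ 2 ≤ a ⬝ᵥ (Y *ᵥ a) := by
  have hpos : ∀ a : Fin g → ℝ, a ≠ 0 → 0 < a ⬝ᵥ (Y *ᵥ a) := fun a ha ↦ by
    simpa using hY.dotProduct_mulVec_pos ha
  have hcont : Continuous fun a : Fin g → ℝ ↦ a ⬝ᵥ (Y *ᵥ a) := by fun_prop
  rcases (Metric.sphere (0 : Fin g → ℝ) 1).eq_empty_or_nonempty with he | hne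
  · refine ⟨1, one_pos, fun a ↦ ?_⟩
    have ha : a = 0 := by
      by_contra ha
      have : ‖a‖⁻¹ • a ∈ Metric.sphere (0 : Fin g → ℝ) 1 := by
        simp [norm_smul, norm_ne_zero_iff.mpr ha]
      rw [he] at this
      exact this
    simp [ha]
  · obtain ⟨x, hx, hmin⟩ := (isCompact_sphere (0 : Fin g → ℝ) 1).exists_isMinOn hne
      hcont.continuousOn
    have hx0 : x ≠ 0 := fun h ↦ by simp [h] at hx
    have hg : 0 < (g : ℝ) := by
      rcases Nat.eq_zero_or_pos g with rfl | h
      · exact absurd (Subsingleton.elim x 0) hx0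
      · exact_mod_cast h
    have hcx := hpos x hx0
    refine ⟨(x ⬝ᵥ (Y *ᵥ x)) / g, by positivity, fun a ↦ ?_⟩
    by_cases ha : a = 0
    · simp [ha]
    have han : 0 < ‖a‖ := norm_pos_iff.mpr ha
    have h1 : x ⬝ᵥ (Y *ᵥ x) ≤ (‖a‖⁻¹ • a) ⬝ᵥ (Y *ᵥ (‖a‖⁻¹ • a)) :=
      hmin (by simp [norm_smul, han.ne'])
    rw [Matrix.mulVec_smul, smul_dotProduct, dotProduct_smul, smul_eq_mul, smul_eq_mul,
      ← mul_assoc, ← mul_inv, ← div_eq_inv_mul, le_div_iff₀ (by positivity)] at h1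
    have h2 : ∑ i, a i ^ 2 ≤ g * (‖a‖ * ‖a‖) := by
      calc ∑ i, a i ^ 2 ≤ ∑ _i : Fin g, ‖a‖ * ‖a‖ := Finset.sum_le_sum fun i _ ↦ by
            have := norm_le_pi_norm a i
            rw [← sq_abs, ← Real.norm_eq_abs, sq]
            gcongr
        _ = g * (‖a‖ * ‖a‖) := by simp
    calc (x ⬝ᵥ (Y *ᵥ x)) / g * ∑ i, a i ^ 2
        ≤ (x ⬝ᵥ (Y *ᵥ x)) / g * (g * (‖a‖ * ‖a‖)) := by gcongr
      _ = (x ⬝ᵥ (Y *ᵥ x)) * (‖a‖ * ‖a‖) := by field_simp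
      _ ≤ _ := h1

/-- The shifted summation index `m + α`. -/
def shiftedIndex {g : ℕ} (α : Fin g → ℝ) (m : Fin g → ℤ) : Fin g → ℝ := fun i ↦ m i + α i

theorem im_dotProduct_mulVec {g : ℕ} (a : Fin g → ℝ) (Ω : Matrix (Fin g) (Fin g) ℂ) :
    ((fun i ↦ (a i : ℂ)) ⬝ᵥ (Ω *ᵥ fun i ↦ (a i : ℂ))).im = a ⬝ᵥ (imMat Ω *ᵥ a) := by
  simp [dotProduct, Matrix.mulVec, imMat]

/-- The characteristic β is real, so it affects only the phase. -/
theorem norm_thetaTerm {g : ℕ} (α β : Fin g → ℝ) (u : Fin g → ℂ) (Ω : Matrix (Fin g) (Fin g) ℂ)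
    (m : Fin g → ℤ) :
    ‖thetaTerm α β u Ω m‖ = Real.exp (-2 * Real.pi * (∑ i, shiftedIndex α m i * (u i).im) -
      Real.pi * (shiftedIndex α m ⬝ᵥ (imMat Ω *ᵥ shiftedIndex α m))) := by
  have ha : (fun i ↦ (m i : ℂ) + (α i : ℂ)) = fun i ↦ (shiftedIndex α m i : ℂ) := by
    funext i; simp [shiftedIndex]
  simp only [thetaTerm, e, ha]
  rw [Complex.norm_exp, ← im_dotProduct_mulVec]
  congr 1
  have h2 : ∀ w : ℂ, (2 * Real.pi * I * w).re = -2 * Real.pi * w.im := fun w ↦ by simp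
  rw [h2, Complex.add_im]
  have h3 : ∀ w : ℂ, (1 / 2 * w).im = w.im / 2 := fun w ↦ by
    rw [one_div, ← Complex.ofReal_ofNat, ← Complex.ofReal_inv, Complex.im_ofReal_mul]; ring
  rw [h3]
  have h4 : ((fun i ↦ (shiftedIndex α m i : ℂ)) ⬝ᵥ (u + fun i ↦ (β i : ℂ))).im =
      ∑ i, shiftedIndex α m i * (u i).im := by
    simp [dotProduct]
  rw [h4]
  ring

/-- The linear form `w ↦ 2πi (m + α) ⬝ w`, the logarithmic derivative of the theta term. -/
noncomputable def thetaForm {g : ℕ} (α : Fin g → ℝ) (m : Fin g → ℤ) : (Fin g → ℂ) →L[ℂ] ℂ :=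
  ∑ i, (2 * Real.pi * I * shiftedIndex α m i : ℂ) • ContinuousLinearMap.proj i

theorem thetaForm_apply {g : ℕ} (α : Fin g → ℝ) (m : Fin g → ℤ) (w : Fin g → ℂ) :
    thetaForm α m w = ∑ i, 2 * Real.pi * I * shiftedIndex α m i * w i := by
  simp [thetaForm]

theorem norm_thetaForm_le {g : ℕ} (α : Fin g → ℝ) (m : Fin g → ℤ) :
    ‖thetaForm α m‖ ≤ 2 * Real.pi * ∑ i, |shiftedIndex α m i| := by
  refine ContinuousLinearMap.opNorm_le_bound _ (by positivity) fun w ↦ ?_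
  rw [thetaForm_apply, Finset.mul_sum, Finset.sum_mul]
  refine (norm_sum_le _ _).trans (Finset.sum_le_sum fun i _ ↦ ?_)
  have := norm_le_pi_norm w i
  simp only [norm_mul, Complex.norm_I, Complex.norm_real, Real.norm_eq_abs, Complex.norm_ofNat,
    abs_of_pos Real.pi_pos, mul_one]
  gcongr

theorem hasFDerivAt_thetaTerm {g : ℕ} (α β : Fin g → ℝ) (Ω : Matrix (Fin g) (Fin g) ℂ)
    (m : Fin g → ℤ) (u : Fin g → ℂ) :
    HasFDerivAt (fun u ↦ thetaTerm α β u Ω m) (thetaTerm α β u Ω m • thetaForm α m) u := by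
  have h : ∀ u, thetaTerm α β u Ω m = cexp (thetaForm α m u + (2 * Real.pi * I) *
      ((fun i ↦ (m i : ℂ) + (α i : ℂ)) ⬝ᵥ (fun i ↦ (β i : ℂ)) + 1 / 2 *
        ((fun i ↦ (m i : ℂ) + (α i : ℂ)) ⬝ᵥ (Ω *ᵥ fun i ↦ (m i : ℂ) + (α i : ℂ))))) := by
    intro u
    have : thetaForm α m u = 2 * Real.pi * I * ((fun i ↦ (m i : ℂ) + (α i : ℂ)) ⬝ᵥ u) := by
      rw [thetaForm_apply, dotProduct, Finset.mul_sum]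
      exact Finset.sum_congr rfl fun i _ ↦ by simp [shiftedIndex]; ring
    rw [this]
    simp only [thetaTerm, e, dotProduct_add]
    congr 1
    ring
  simp only [h]
  exact ((thetaForm α m).hasFDerivAt.add_const _).cexp

/-- The series `∑ c(m) e((m+α)ᵗʳ(u+β) + ½ (m+α)ᵗʳ Ω (m+α))`. -/
noncomputable def weightedTheta {g : ℕ} (c : (Fin g → ℤ) → ℂ) (α β : Fin g → ℝ)
    (Ω : Matrix (Fin g) (Fin g) ℂ) (u : Fin g → ℂ) : ℂ :=
  ∑' m : Fin g → ℤ, c m * thetaTerm α β u Ω m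

section Convergence

variable {g : ℕ} {α : Fin g → ℝ} (β : Fin g → ℝ) {Ω : Matrix (Fin g) (Fin g) ℂ}
  {c : (Fin g → ℤ) → ℂ} {K : ℝ}

/-- The Gaussian decay from Im Ω absorbs weights of exponential growth. Uniformity on balls is what
termwise differentiation requires. -/
theorem exists_summable_bound (hΩ : (imMat Ω).PosDef)
    (hc : ∀ m, ‖c m‖ ≤ Real.exp (K * ∑ i, |shiftedIndex α m i|)) (R : ℝ) :
    ∃ b : (Fin g → ℤ) → ℝ, Summable b ∧ ∀ m, ∀ u : Fin g → ℂ, ‖u‖ ≤ R →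
      ‖c m * thetaTerm α β u Ω m‖ ≤ b m := by
  obtain ⟨d, hd, hQ⟩ := exists_pos_mul_sum_sq_le hΩ
  refine ⟨_, summable_exp_linear_sub_sq g α (K + 2 * Real.pi * R)
    (B := Real.pi * d) (by positivity), fun m u hu ↦ ?_⟩
  rw [norm_mul, norm_thetaTerm]
  refine (mul_le_mul_of_nonneg_right (hc m) (Real.exp_pos _).le).trans ?_
  rw [← Real.exp_add, Real.exp_le_exp, Finset.sum_sub_distrib, ← Finset.mul_sum, ← Finset.mul_sum]
  have h1 : -(∑ i, shiftedIndex α m i * (u i).im) ≤ R * ∑ i, |shiftedIndex α m i| := by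
    rw [← Finset.sum_neg_distrib, Finset.mul_sum]
    refine Finset.sum_le_sum fun i _ ↦ ?_
    have h2 : |(u i).im| ≤ R := (Complex.abs_im_le_norm _).trans ((norm_le_pi_norm u i).trans hu)
    calc -(shiftedIndex α m i * (u i).im) ≤ |shiftedIndex α m i * (u i).im| := neg_le_abs _
      _ = |(u i).im| * |shiftedIndex α m i| := by rw [abs_mul, mul_comm]
      _ ≤ R * |shiftedIndex α m i| := by gcongr
  have h3 := mul_le_mul_of_nonneg_left h1 (by positivity : 0 ≤ 2 * Real.pi)
  have h4 := mul_le_mul_of_nonneg_left (hQ (shiftedIndex α m)) Real.pi_pos.le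
  change _ ≤ (K + 2 * Real.pi * R) * ∑ i, |shiftedIndex α m i| -
    Real.pi * d * ∑ i, shiftedIndex α m i ^ 2
  linarith

theorem summable_weightedTheta (hΩ : (imMat Ω).PosDef)
    (hc : ∀ m, ‖c m‖ ≤ Real.exp (K * ∑ i, |shiftedIndex α m i|)) (u : Fin g → ℂ) :
    Summable fun m ↦ c m * thetaTerm α β u Ω m := by
  obtain ⟨b, hb, h⟩ := exists_summable_bound β hΩ hc ‖u‖
  exact Summable.of_norm_bounded hb fun m ↦ h m u le_rfl

/-- As x ≤ exp x, the linear factor produced by differentiation only raises K by 2π; the class of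
admissible weights is thus closed under differentiation. -/
theorem norm_shiftedIndex_mul_le
    (hc : ∀ m, ‖c m‖ ≤ Real.exp (K * ∑ i, |shiftedIndex α m i|)) (m : Fin g → ℤ) :
    ‖c m‖ * (2 * Real.pi * ∑ i, |shiftedIndex α m i|) ≤
      Real.exp ((K + 2 * Real.pi) * ∑ i, |shiftedIndex α m i|) := by
  rw [add_mul, Real.exp_add]
  refine mul_le_mul (hc m) ?_ (by positivity) (Real.exp_pos _).le
  linarith [Real.add_one_le_exp (2 * Real.pi * ∑ i, |shiftedIndex α m i|)]

theorem norm_thetaForm_weight_le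
    (hc : ∀ m, ‖c m‖ ≤ Real.exp (K * ∑ i, |shiftedIndex α m i|)) (j : Fin g) (m : Fin g → ℤ) :
    ‖c m * (2 * Real.pi * I * shiftedIndex α m j)‖ ≤
      Real.exp ((K + 2 * Real.pi) * ∑ i, |shiftedIndex α m i|) := by
  refine le_trans ?_ (norm_shiftedIndex_mul_le hc m)
  simp only [norm_mul, Complex.norm_I, Complex.norm_real, Real.norm_eq_abs, Complex.norm_ofNat,
    abs_of_pos Real.pi_pos, mul_one]
  gcongr
  exact Finset.single_le_sum (f := fun i ↦ |shiftedIndex α m i|) (fun i _ ↦ abs_nonneg _)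
    (Finset.mem_univ j)

theorem hasFDerivAt_weightedTheta (hΩ : (imMat Ω).PosDef)
    (hc : ∀ m, ‖c m‖ ≤ Real.exp (K * ∑ i, |shiftedIndex α m i|)) (u : Fin g → ℂ) :
    HasFDerivAt (weightedTheta c α β Ω)
      (∑' m, (c m * thetaTerm α β u Ω m) • thetaForm α m) u ∧
    Summable fun m ↦ (c m * thetaTerm α β u Ω m) • thetaForm α m := by
  -- This real weight dominates the norms of the differentiated terms, so the uniform bound for it
  -- serves the derivative series.
  have hc' : ∀ m, ‖((‖c m‖ * (2 * Real.pi * ∑ i, |shiftedIndex α m i|) : ℝ) : ℂ)‖ ≤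
      Real.exp ((K + 2 * Real.pi) * ∑ i, |shiftedIndex α m i|) := fun m ↦ by
    rw [Complex.norm_real, Real.norm_of_nonneg (by positivity)]
    exact norm_shiftedIndex_mul_le hc m
  obtain ⟨b, hb, h⟩ := exists_summable_bound β hΩ hc' (‖u‖ + 1)
  have hbound : ∀ m, ∀ v ∈ Metric.ball (0 : Fin g → ℂ) (‖u‖ + 1),
      ‖(c m * thetaTerm α β v Ω m) • thetaForm α m‖ ≤ b m := fun m v hv ↦ by
    refine le_trans ?_ (h m v (mem_ball_zero_iff.mp hv).le)
    rw [norm_smul, norm_mul, norm_mul, Complex.norm_real, Real.norm_of_nonneg (by positivity),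
      mul_right_comm]
    gcongr
    exact norm_thetaForm_le α m
  have hu : u ∈ Metric.ball (0 : Fin g → ℂ) (‖u‖ + 1) := by simp
  refine ⟨hasFDerivAt_tsum_of_isPreconnected hb Metric.isOpen_ball
    (convex_ball _ _).isPreconnected (fun m v _ ↦ ?_) hbound hu
    (summable_weightedTheta β hΩ hc u) hu, Summable.of_norm_bounded hb fun m ↦ hbound m u hu⟩
  rw [mul_smul]
  exact (hasFDerivAt_thetaTerm α β Ω m v).const_mul (c m)

theorem fderiv_weightedTheta_single (hΩ : (imMat Ω).PosDef)
    (hc : ∀ m, ‖c m‖ ≤ Real.exp (K * ∑ i, |shiftedIndex α m i|)) (u : Fin g → ℂ) (j : Fin g) :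
    fderiv ℂ (weightedTheta c α β Ω) u (Pi.single j 1) =
      weightedTheta (fun m ↦ c m * (2 * Real.pi * I * shiftedIndex α m j)) α β Ω u := by
  obtain ⟨h, hs⟩ := hasFDerivAt_weightedTheta β hΩ hc u
  rw [h.fderiv]
  refine ((ContinuousLinearMap.apply ℂ ℂ (Pi.single j (1 : ℂ))).map_tsum hs).trans
    (tsum_congr fun m ↦ ?_)
  simp [thetaForm_apply, Pi.single_apply]
  ring

theorem theta_eq_weightedTheta : (fun u ↦ theta α β u Ω) = weightedTheta 1 α β Ω := by
  funext u; simp [theta, weightedTheta]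

theorem norm_one_weight_le (m : Fin g → ℤ) :
    ‖(1 : (Fin g → ℤ) → ℂ) m‖ ≤ Real.exp (0 * ∑ i, |shiftedIndex α m i|) := by simp

theorem summable_thetaTerm (hΩ : (imMat Ω).PosDef) (u : Fin g → ℂ) :
    Summable (thetaTerm α β u Ω) := by
  simpa using summable_weightedTheta β hΩ (norm_one_weight_le (α := α)) u

theorem differentiable_theta (hΩ : (imMat Ω).PosDef) :
    Differentiable ℂ fun u ↦ theta α β u Ω := by
  rw [theta_eq_weightedTheta]
  exact fun u ↦ (hasFDerivAt_weightedTheta β hΩ norm_one_weight_le u).1.differentiableAt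

/-- The partial derivatives of θ are weighted theta series again. This second derivative makes ∇ log
θ holomorphic off the zeros of θ. -/
theorem differentiable_fderiv_theta (hΩ : (imMat Ω).PosDef) (w : Fin g → ℂ) :
    Differentiable ℂ fun u ↦ fderiv ℂ (fun u ↦ theta α β u Ω) u w := by
  have h : (fun u ↦ fderiv ℂ (fun u ↦ theta α β u Ω) u w) = fun u ↦
      ∑ j, w j * weightedTheta (fun m ↦ (1 : (Fin g → ℤ) → ℂ) m *
        (2 * Real.pi * I * shiftedIndex α m j)) α β Ω u := by
    funext u
    rw [theta_eq_weightedTheta]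
    conv_lhs => rw [pi_eq_sum_univ' w, map_sum]
    refine Finset.sum_congr rfl fun j _ ↦ ?_
    rw [← fderiv_weightedTheta_single β hΩ norm_one_weight_le, map_smul, smul_eq_mul]
  rw [h]
  refine Differentiable.fun_sum fun j _ ↦ Differentiable.const_mul (fun u ↦ ?_) _
  exact (hasFDerivAt_weightedTheta β hΩ
    (norm_thetaForm_weight_le norm_one_weight_le j) u).1.differentiableAt

end Convergence

/-! ### Quasi-periodicity -/

/-- The factor of automorphy `e(αᵗʳ m - nᵗʳ (v + β) - ½ nᵗʳ Ω n)` of the theta function. -/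
noncomputable def thetaFactor {g : ℕ} (α β : Fin g → ℝ) (Ω : Matrix (Fin g) (Fin g) ℂ)
    (m n : Fin g → ℤ) (v : Fin g → ℂ) : ℂ :=
  e ((fun i ↦ (α i : ℂ)) ⬝ᵥ (fun i ↦ (m i : ℂ)) -
    (fun i ↦ (n i : ℂ)) ⬝ᵥ (v + fun i ↦ (β i : ℂ)) -
    1 / 2 * ((fun i ↦ (n i : ℂ)) ⬝ᵥ (Ω *ᵥ fun i ↦ (n i : ℂ))))

theorem e_add (x y : ℂ) : e (x + y) = e x * e y := by
  simp only [e, mul_add, Complex.exp_add]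

theorem e_add_int (x : ℂ) (k : ℤ) : e (x + k) = e x := by
  simp only [e, mul_add, Complex.exp_add]
  rw [show 2 * (Real.pi : ℂ) * I * k = k * (2 * Real.pi * I) by ring, Complex.exp_int_mul_two_pi_mul_I,
    mul_one]

/-- Completing the square: symmetry of Ω merges the cross terms, and Ωn becomes a shift of the index
k by n. -/
theorem thetaTerm_add_lattice {g : ℕ} (α β : Fin g → ℝ) {Ω : Matrix (Fin g) (Fin g) ℂ}
    (hΩ : Ωᵀ = Ω) (m n k : Fin g → ℤ) (v : Fin g → ℂ) :
    thetaTerm α β (v + ((fun i ↦ (m i : ℂ)) + Ω *ᵥ fun i ↦ (n i : ℂ))) Ω k =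
      thetaFactor α β Ω m n v * thetaTerm α β v Ω (k + n) := by
  set m' : Fin g → ℂ := fun i ↦ (m i : ℂ) with hm'
  set n' : Fin g → ℂ := fun i ↦ (n i : ℂ) with hn'
  set a : Fin g → ℂ := fun i ↦ (α i : ℂ) with ha
  set k' : Fin g → ℂ := fun i ↦ (k i : ℂ) with hk'
  set b : Fin g → ℂ := fun i ↦ (β i : ℂ) with hb
  have h1 : (fun i ↦ ((k + n) i : ℂ) + (α i : ℂ)) = k' + n' + a := by
    funext i; simp [hk', hn', ha]
  have h2 : (fun i ↦ (k i : ℂ) + (α i : ℂ)) = k' + a := rfl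
  have h3 : k' ⬝ᵥ m' = ((∑ i, k i * m i : ℤ) : ℂ) := by simp [dotProduct, hk', hm']
  have hsymm : ∀ x y : Fin g → ℂ, x ⬝ᵥ (Ω *ᵥ y) = y ⬝ᵥ (Ω *ᵥ x) := fun x y ↦ by
    rw [Matrix.dotProduct_mulVec, ← Matrix.mulVec_transpose, hΩ, dotProduct_comm]
  simp only [thetaTerm, thetaFactor, h1, h2]
  rw [← hb, ← ha, ← hm', ← hn', ← e_add]
  -- The left side has the extra term kᵗʳm, an integer, invisible to `e`.
  conv_rhs => rw [← e_add_int _ (∑ i, k i * m i), ← h3]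
  congr 1
  simp only [dotProduct_add, add_dotProduct, Matrix.mulVec_add]
  rw [hsymm n' k', hsymm n' a, hsymm a k']
  ring

theorem theta_add_lattice {g : ℕ} (α β : Fin g → ℝ) {Ω : Matrix (Fin g) (Fin g) ℂ}
    (hΩ : Ωᵀ = Ω) (m n : Fin g → ℤ) (v : Fin g → ℂ) :
    theta α β (v + ((fun i ↦ (m i : ℂ)) + Ω *ᵥ fun i ↦ (n i : ℂ))) Ω =
      thetaFactor α β Ω m n v * theta α β v Ω := by
  simp only [theta, thetaTerm_add_lattice α β hΩ m n]
  rw [tsum_mul_left, ← (Equiv.addRight n).tsum_eq (thetaTerm α β v Ω)]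
  rfl

/-! ### Eichler integrals -/

theorem one_mem_strictPeriods_Gamma0 (N : ℕ) :
    (1 : ℝ) ∈ (Gamma0 N : Subgroup (GL (Fin 2) ℝ)).strictPeriods := by
  rw [strictPeriods_Gamma0]
  exact AddSubgroup.mem_zmultiples 1

theorem im_pos_vertical (τ : ℍ) {t : ℝ} (ht : 0 ≤ t) : 0 < ((τ : ℂ) + t * I).im := by
  have := τ.im_pos
  simp only [Complex.add_im, Complex.mul_im, Complex.ofReal_re, Complex.I_im, Complex.ofReal_im,
    Complex.I_re, mul_one, mul_zero, add_zero]
  exact add_pos_of_pos_of_nonneg this ht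

theorem tendsto_vertical (τ : ℍ) :
    Filter.Tendsto (fun t : ℝ ↦ (τ : ℂ) + t * I) Filter.atTop
      (Filter.comap Complex.im Filter.atTop) := by
  rw [Filter.tendsto_comap_iff]
  refine (Filter.tendsto_atTop_add_const_left _ τ.im Filter.tendsto_id).congr fun t ↦ ?_
  simp

theorem differentiableAt_cuspForm {N : ℕ} (f : S2 N) {z : ℂ} (hz : 0 < z.im) :
    DifferentiableAt ℂ (fun z ↦ f (ofComplex z)) z :=
  UpperHalfPlane.mdifferentiableAt_iff.mp (CuspFormClass.holo f ⟨z, hz⟩)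

theorem continuousOn_eichlerIntegrand {N : ℕ} (f : S2 N) (τ : ℍ) :
    ContinuousOn (eichlerIntegrand f τ) (Set.Ici 0) := by
  intro t ht
  refine ContinuousAt.continuousWithinAt (ContinuousAt.mul ?_ continuousAt_const)
  refine ContinuousAt.comp (f := fun t : ℝ ↦ (τ : ℂ) + t * I) (g := fun z ↦ f (ofComplex z))
    (differentiableAt_cuspForm f (im_pos_vertical τ ht)).continuousAt ?_
  fun_prop

/-- The integrand is continuous up to t = 0 and decays like exp(-2πt), since i∞ is a cusp of width
1. -/
theorem integrableOn_eichlerIntegrand {N : ℕ} (f : S2 N) (τ : ℍ) :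
    IntegrableOn (eichlerIntegrand f τ) (Set.Ioi (0 : ℝ)) := by
  refine (integrable_norm_iff (((continuousOn_eichlerIntegrand f τ).mono
    Set.Ioi_subset_Ici_self).aestronglyMeasurable measurableSet_Ioi)).mp ?_
  refine integrable_of_isBigO_exp_neg (b := 2 * Real.pi) (by positivity)
    (continuousOn_eichlerIntegrand f τ).norm (Asymptotics.IsBigO.norm_left ?_)
  have h1 : (fun t : ℝ ↦ f (ofComplex ((τ : ℂ) + t * I))) =O[Filter.atTop]
      fun t : ℝ ↦ Real.exp (-2 * Real.pi * (ofComplex ((τ : ℂ) + t * I)).im / 1) :=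
    (CuspFormClass.exp_decay_atImInfty f one_pos (one_mem_strictPeriods_Gamma0 N)).comp_tendsto
      (UpperHalfPlane.tendsto_comap_im_ofComplex.comp (tendsto_vertical τ))
  have h2 : eichlerIntegrand f τ =O[Filter.atTop] fun t : ℝ ↦ f (ofComplex ((τ : ℂ) + t * I)) :=
    Asymptotics.isBigO_of_le _ fun t ↦ by simp [eichlerIntegrand]
  refine (h2.trans h1).trans (Asymptotics.IsBigO.of_bound 1 ?_)
  filter_upwards [Filter.eventually_ge_atTop 0] with t ht
  rw [ofComplex_apply_of_im_pos (im_pos_vertical τ ht), one_mul, Real.norm_of_nonneg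
    (Real.exp_pos _).le, Real.norm_of_nonneg (Real.exp_pos _).le, Real.exp_le_exp]
  have : (UpperHalfPlane.mk ((τ : ℂ) + t * I) (im_pos_vertical τ ht)).im = τ.im + t := by
    change ((τ : ℂ) + t * I).im = _
    simp
  rw [this]
  nlinarith [mul_pos Real.pi_pos τ.im_pos]

theorem hasDerivAt_qParam_one (z : ℂ) :
    HasDerivAt (Function.Periodic.qParam 1)
      (2 * Real.pi * I * Function.Periodic.qParam 1 z) z := by
  have h : Function.Periodic.qParam 1 = fun z ↦ cexp (2 * Real.pi * I * z) := by
    funext z; simp [Function.Periodic.qParam]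
  rw [h]
  simpa [mul_comm] using ((hasDerivAt_id z).const_mul (2 * Real.pi * I : ℂ)).cexp

/-- The Eichler integral of a cusp form is a holomorphic function of `q = exp (2πiτ)`. -/
theorem exists_eichler_primitive {N : ℕ} (f : S2 N) :
    ∃ E : ℂ → ℂ, (∀ z : ℂ, 0 < z.im → HasDerivAt E (2 * Real.pi * I * f (ofComplex z)) z) ∧
      ∀ τ : ℍ, -2 * Real.pi * I * ∫ t in Set.Ioi (0 : ℝ), eichlerIntegrand f τ t = E τ := by
  have hp := one_mem_strictPeriods_Gamma0 N
  set G := cuspFunction 1 f with hG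
  have hG0 : G 0 = 0 := CuspFormClass.cuspFunction_apply_zero f one_pos hp
  have hGd : DifferentiableOn ℂ (dslope G 0) (Metric.ball 0 1) :=
    (Complex.differentiableOn_dslope (Metric.ball_mem_nhds _ one_pos)).mpr fun q hq ↦
      (ModularFormClass.differentiableAt_cuspFunction f one_pos hp
        (mem_ball_zero_iff.mp hq)).differentiableWithinAt
  -- As G(0) = 0, the form 2πi f dz equals (G(q)/q) dq, holomorphic on the whole disc; `dslope G 0`
  -- is G(q)/q. The choice H(0) = 0 makes the primitive vanish at i∞.
  obtain ⟨H, hH0, hH⟩ := hGd.isExactOn_ball.with_val_at 0 0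
  have hq : ∀ z : ℂ, 0 < z.im →
      Function.Periodic.qParam 1 z ∈ Metric.ball (0 : ℂ) 1 := fun z hz ↦
    mem_ball_zero_iff.mpr (Function.Periodic.norm_qParam_lt_one one_pos hz)
  have hE : ∀ z : ℂ, 0 < z.im → HasDerivAt (fun z ↦ H (Function.Periodic.qParam 1 z))
      (2 * Real.pi * I * f (ofComplex z)) z := by
    intro z hz
    have h1 := (hH _ (hq z hz)).comp z (hasDerivAt_qParam_one z)
    convert! h1 using 1
    have h2 := SlashInvariantFormClass.eq_cuspFunction f (ofComplex z) hp one_ne_zero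
    rw [ofComplex_apply_of_im_pos hz] at h2 ⊢
    have h3 := sub_smul_dslope_of_zero hG0 (Function.Periodic.qParam 1 z)
    rw [sub_zero, smul_eq_mul] at h3
    rw [← h2, ← hG, coe_mk, ← h3]
    ring
  refine ⟨_, hE, fun τ ↦ ?_⟩
  have hlim : Filter.Tendsto (fun t : ℝ ↦ H (Function.Periodic.qParam 1 ((τ : ℂ) + t * I)))
      Filter.atTop (𝓝 0) := by
    have h1 : Filter.Tendsto H (𝓝 0) (𝓝 0) := by
      have := (hH 0 (Metric.mem_ball_self one_pos)).continuousAt.tendsto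
      rwa [hH0] at this
    exact h1.comp (((Function.Periodic.qParam_tendsto one_pos).mono_right
      nhdsWithin_le_nhds).comp (tendsto_vertical τ))
  have hint := integral_Ioi_of_hasDerivAt_of_tendsto' (a := 0)
    (f := fun t : ℝ ↦ H (Function.Periodic.qParam 1 ((τ : ℂ) + t * I)))
    (f' := fun t ↦ 2 * Real.pi * I * eichlerIntegrand f τ t) (fun t ht ↦ ?_)
    ((integrableOn_eichlerIntegrand f τ).const_mul _) hlim
  · rw [integral_const_mul] at hint
    simp only [Complex.ofReal_zero, zero_mul, add_zero, zero_sub] at hint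
    linear_combination -hint
  · have h1 : HasDerivAt (fun t : ℝ ↦ (τ : ℂ) + t * I) I t := by
      simpa using ((Complex.ofRealCLM.hasDerivAt (x := t)).mul_const I).const_add (τ : ℂ)
    have h2 := (hE _ (im_pos_vertical τ ht)).comp t h1
    convert! h2 using 1
    simp only [eichlerIntegrand]
    ring

theorem hasDerivAt_eichlerIntegral {N r : ℕ} (F : Fin r → S2 N) (j : Fin r) {z : ℂ}
    (hz : 0 < z.im) :
    HasDerivAt (fun z ↦ eichlerIntegral F (ofComplex z) j)
      (2 * Real.pi * I * F j (ofComplex z)) z := by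
  obtain ⟨E, hE, hEq⟩ := exists_eichler_primitive (F j)
  refine (hE z hz).congr_of_eventuallyEq ?_
  filter_upwards [isOpen_upperHalfPlaneSet.mem_nhds hz] with w hw
  rw [eichlerIntegral, hEq, ofComplex_apply_of_im_pos hw]

/-- The period carries -2πi whereas the Eichler integral has derivative 2πi f, hence start minus
end. -/
theorem pathPeriod_eq_sub {N r : ℕ} (F : Fin r → S2 N) {c : ℝ → ℂ} (hc : ContDiff ℝ 1 c)
    (him : ∀ t ∈ Set.Icc (0 : ℝ) 1, 0 < (c t).im) :
    pathPeriod F c = eichlerIntegral F (ofComplex (c 0)) - eichlerIntegral F (ofComplex (c 1)) := by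
  funext j
  have hI : Set.uIcc (0 : ℝ) 1 = Set.Icc 0 1 := Set.uIcc_of_le zero_le_one
  have hcont : ContinuousOn (fun t ↦ F j (ofComplex (c t)) * deriv c t) (Set.uIcc 0 1) := by
    intro t ht
    rw [hI] at ht
    refine ((ContinuousAt.comp (f := c) (g := fun z ↦ F j (ofComplex z))
      (differentiableAt_cuspForm (F j) (him t ht)).continuousAt
      hc.continuous.continuousAt).mul ?_).continuousWithinAt
    exact (hc.continuous_deriv le_rfl).continuousAt
  have hint := intervalIntegral.integral_eq_sub_of_hasDerivAt
    (f := fun t ↦ eichlerIntegral F (ofComplex (c t)) j)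
    (f' := fun t ↦ 2 * Real.pi * I * (F j (ofComplex (c t)) * deriv c t)) (fun t ht ↦ ?_)
    (hcont.intervalIntegrable.const_mul _)
  · rw [intervalIntegral.integral_const_mul] at hint
    rw [pathPeriod, Pi.sub_apply]
    linear_combination -hint
  · rw [hI] at ht
    have h := (hasDerivAt_eichlerIntegral F j (him t ht)).comp t
      (hc.differentiable one_ne_zero t).hasDerivAt
    convert! h using 1
    ring

/-- The segment from τ to γτ stays in the convex set ℍ and closes up in the quotient. -/
theorem eichlerIntegral_smul_sub_mem {N r : ℕ} (F : Fin r → S2 N) {γ : SL(2, ℤ)}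
    (hγ : γ ∈ Gamma0 N) (τ : ℍ) :
    eichlerIntegral F (γ • τ) - eichlerIntegral F τ ∈ periodLattice F := by
  set c : ℝ → ℂ := fun t ↦ (τ : ℂ) + t * (((γ • τ : ℍ) : ℂ) - τ) with hc
  have hcd : ContDiff ℝ 1 c :=
    contDiff_const.add ((Complex.ofRealCLM.contDiff).mul contDiff_const)
  have h0 : c 0 = τ := by simp [hc]
  have h1 : c 1 = ((γ • τ : ℍ) : ℂ) := by simp [hc]
  have him : ∀ t ∈ Set.Icc (0 : ℝ) 1, 0 < (c t).im := by
    intro t ht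
    have h : (c t).im = (1 - t) * τ.im + t * (γ • τ : ℍ).im := by
      simp [hc]; ring
    rw [h]
    rcases ht.1.eq_or_lt with rfl | h'
    · simpa using τ.im_pos
    · exact add_pos_of_nonneg_of_pos (mul_nonneg (sub_nonneg.mpr ht.2) τ.im_pos.le)
        (mul_pos h' (γ • τ : ℍ).im_pos)
  have hmem : pathPeriod F c ∈ periodLattice F :=
    AddSubgroup.subset_closure ⟨c, ⟨hcd, him, γ, hγ,
      by rw [h0, h1, ofComplex_apply, ofComplex_apply]⟩,
      rfl⟩
  rw [pathPeriod_eq_sub F hcd him, h0, h1, ofComplex_apply, ofComplex_apply] at hmem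
  simpa using neg_mem hmem

/-! ### The Kleinian functions -/

/-- A complex matrix as a continuous linear map. -/
noncomputable def matrixCLM {g : ℕ} (A : Matrix (Fin g) (Fin g) ℂ) :
    (Fin g → ℂ) →L[ℂ] (Fin g → ℂ) :=
  LinearMap.toContinuousLinearMap A.mulVecLin

theorem matrixCLM_apply {g : ℕ} (A : Matrix (Fin g) (Fin g) ℂ) (u : Fin g → ℂ) :
    matrixCLM A u = A *ᵥ u := rfl

theorem exists_hasFDerivAt_quadratic {g : ℕ} (A : Matrix (Fin g) (Fin g) ℂ) (u : Fin g → ℂ) :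
    ∃ L : (Fin g → ℂ) →L[ℂ] ℂ, HasFDerivAt (fun u ↦ u ⬝ᵥ (A *ᵥ u)) L u ∧
      ∀ i, L (Pi.single i 1) = (u ᵥ* (A + Aᵀ)) i := by
  have h : ∀ i, HasFDerivAt (fun u : Fin g → ℂ ↦ u i * (A *ᵥ u) i) _ u := fun i ↦
    (ContinuousLinearMap.proj (R := ℂ) (φ := fun _ : Fin g ↦ ℂ) i).hasFDerivAt.mul
      ((ContinuousLinearMap.proj (R := ℂ) (φ := fun _ : Fin g ↦ ℂ) i).comp
        (matrixCLM A)).hasFDerivAt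
  refine ⟨_, HasFDerivAt.fun_sum fun i _ ↦ h i, fun i ↦ ?_⟩
  simp [matrixCLM_apply, Matrix.vecMul_add, Matrix.vecMul_transpose, Finset.sum_add_distrib,
    Pi.single_apply]
  simp [Matrix.vecMul, dotProduct]

section ZetaFunction

variable {g : ℕ} {ω ω' : Matrix (Fin g) (Fin g) ℂ} (η : Matrix (Fin g) (Fin g) ℂ)
  {α : Fin g → ℝ} (β : Fin g → ℝ)

theorem sigma_ne_zero_iff (u : Fin g → ℂ) :
    sigma ω ω' η α β u ≠ 0 ↔ theta α β (ω⁻¹ *ᵥ u) (ω⁻¹ * ω') ≠ 0 := by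
  simp [sigma, Complex.exp_ne_zero]

theorem exists_hasFDerivAt_sigma (hΩ : (imMat (ω⁻¹ * ω')).PosDef) (u : Fin g → ℂ) :
    ∃ L : (Fin g → ℂ) →L[ℂ] ℂ, HasFDerivAt (sigma ω ω' η α β) L u ∧
      ∀ i, L (Pi.single i 1) = cexp (1 / 2 * (u ⬝ᵥ ((ω⁻¹ * η) *ᵥ u))) *
        (1 / 2 * (u ᵥ* (ω⁻¹ * η + ηᵀ * (ω⁻¹)ᵀ)) i * theta α β (ω⁻¹ *ᵥ u) (ω⁻¹ * ω') +
          fderiv ℂ (fun v ↦ theta α β v (ω⁻¹ * ω')) (ω⁻¹ *ᵥ u) (ω⁻¹ *ᵥ Pi.single i 1)) := by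
  obtain ⟨Q, hQ, hQi⟩ := exists_hasFDerivAt_quadratic (ω⁻¹ * η) u
  have hθ := ((differentiable_theta (α := α) β hΩ (ω⁻¹ *ᵥ u)).hasFDerivAt).comp u
    (matrixCLM ω⁻¹).hasFDerivAt
  refine ⟨_, (hQ.const_mul (1 / 2)).cexp.mul hθ, fun i ↦ ?_⟩
  simp only [add_apply, smul_apply, hQi, smul_eq_mul,
    ContinuousLinearMap.comp_apply, matrixCLM_apply, Matrix.transpose_mul]
  ring

theorem differentiable_sigma (hΩ : (imMat (ω⁻¹ * ω')).PosDef) :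
    Differentiable ℂ (sigma ω ω' η α β) := fun u ↦
  (exists_hasFDerivAt_sigma η β hΩ u).choose_spec.1.differentiableAt

/-- The exponential factor cancels in ∇σ/σ, leaving the gradient of its exponent. -/
theorem zeta_apply (hΩ : (imMat (ω⁻¹ * ω')).PosDef) {u : Fin g → ℂ}
    (hu : theta α β (ω⁻¹ *ᵥ u) (ω⁻¹ * ω') ≠ 0) (i : Fin g) :
    zeta ω ω' η α β u i = 1 / 2 * (u ᵥ* (ω⁻¹ * η + ηᵀ * (ω⁻¹)ᵀ)) i +
      fderiv ℂ (fun v ↦ theta α β v (ω⁻¹ * ω')) (ω⁻¹ *ᵥ u) (ω⁻¹ *ᵥ Pi.single i 1) /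
        theta α β (ω⁻¹ *ᵥ u) (ω⁻¹ * ω') := by
  obtain ⟨L, hL, hLi⟩ := exists_hasFDerivAt_sigma η β hΩ u
  rw [zeta, hL.fderiv, hLi, sigma, mul_div_mul_left _ _ (Complex.exp_ne_zero _)]
  field_simp

/-- The completed `ζ`-function in terms of the logarithmic derivative of the theta function. -/
theorem zetaHat_apply (hΩ : (imMat (ω⁻¹ * ω')).PosDef) {u : Fin g → ℂ}
    (hu : theta α β (ω⁻¹ *ᵥ u) (ω⁻¹ * ω') ≠ 0) (i : Fin g) :
    zetaHat ω ω' η α β u i =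
      fderiv ℂ (fun v ↦ theta α β v (ω⁻¹ * ω')) (ω⁻¹ *ᵥ u) (ω⁻¹ *ᵥ Pi.single i 1) /
        theta α β (ω⁻¹ *ᵥ u) (ω⁻¹ * ω') +
      2 * Real.pi * I * ((fun i ↦ (((ω⁻¹ *ᵥ u) i).im : ℂ)) ᵥ*
        ((imMat (ω⁻¹ * ω'))⁻¹.map Complex.ofReal * ω⁻¹)) i := by
  simp only [zetaHat, Pi.add_apply, Pi.sub_apply, Pi.smul_apply, zeta_apply η β hΩ hu, smul_eq_mul]
  ring

/-- `σ` has a holomorphic logarithm near each of its non-zeros. -/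
theorem exists_log_sigma (hΩ : (imMat (ω⁻¹ * ω')).PosDef) {u : Fin g → ℂ}
    (hu : sigma ω ω' η α β u ≠ 0) :
    ∃ L : (Fin g → ℂ) → ℂ, ∀ᶠ v in 𝓝 u,
      DifferentiableAt ℂ L v ∧ cexp (L v) = sigma ω ω' η α β v ∧
      ∀ i, fderiv ℂ L v (Pi.single i 1) = zeta ω ω' η α β v i := by
  have hd := differentiable_sigma (α := α) η β hΩ
  set s := sigma ω ω' η α β with hs
  -- Dividing by s(u) moves the value at u to 1, away from the branch cut of the principal
  -- logarithm.
  refine ⟨fun v ↦ Complex.log (s v / s u) + Complex.log (s u), ?_⟩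
  have hc : ContinuousAt (fun v ↦ s v / s u) u := (hd.continuous.div_const _).continuousAt
  have hsl : ∀ᶠ v in 𝓝 u, s v / s u ∈ Complex.slitPlane :=
    hc.eventually_mem (Complex.isOpen_slitPlane.mem_nhds (by simp [hu]))
  filter_upwards [hsl] with v hv
  have hv0 : s v ≠ 0 := fun h ↦ Complex.slitPlane_ne_zero hv (by simp [h])
  have hD := (((hd v).hasFDerivAt.mul_const (s u)⁻¹).clog
    (by simpa [div_eq_mul_inv] using hv)).add_const (Complex.log (s u))
  simp only [← div_eq_mul_inv] at hD
  refine ⟨hD.differentiableAt, ?_, fun i ↦ ?_⟩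
  · rw [Complex.exp_add, Complex.exp_log (div_ne_zero hv0 hu), Complex.exp_log hu,
      div_mul_cancel₀ _ hu]
  · rw [hD.fderiv, zeta]
    simp only [smul_apply, smul_eq_mul, ← hs]
    field_simp

/-! ### Periodicity of the completed zeta function -/

theorem thetaForm_zero_apply (n : Fin g → ℤ) (w : Fin g → ℂ) :
    thetaForm 0 n w = 2 * Real.pi * I * ((fun i ↦ (n i : ℂ)) ⬝ᵥ w) := by
  rw [thetaForm_apply, dotProduct, Finset.mul_sum]
  exact Finset.sum_congr rfl fun i _ ↦ by simp [shiftedIndex]; ring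

theorem hasFDerivAt_thetaFactor (Ω : Matrix (Fin g) (Fin g) ℂ) (m n : Fin g → ℤ)
    (v : Fin g → ℂ) :
    HasFDerivAt (thetaFactor α β Ω m n) (thetaFactor α β Ω m n v • -thetaForm 0 n) v := by
  have h : thetaFactor α β Ω m n = fun v ↦ cexp ((-thetaForm 0 n) v + 2 * Real.pi * I *
      ((fun i ↦ (α i : ℂ)) ⬝ᵥ (fun i ↦ (m i : ℂ)) -
        (fun i ↦ (n i : ℂ)) ⬝ᵥ (fun i ↦ (β i : ℂ)) -
        1 / 2 * ((fun i ↦ (n i : ℂ)) ⬝ᵥ (Ω *ᵥ fun i ↦ (n i : ℂ))))) := by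
    funext v
    rw [neg_apply, thetaForm_zero_apply]
    simp only [thetaFactor, e, dotProduct_add]
    congr 1
    ring
  rw [h]
  exact ((-thetaForm 0 n).hasFDerivAt.add_const _).cexp

theorem thetaFactor_ne_zero (Ω : Matrix (Fin g) (Fin g) ℂ) (m n : Fin g → ℤ) (v : Fin g → ℂ) :
    thetaFactor α β Ω m n v ≠ 0 := Complex.exp_ne_zero _

/-- The logarithm of the factor of automorphy is affine in v with linear part -2πi nᵗʳv; m enters
only its constant term. -/
theorem logDeriv_theta_add_lattice {Ω : Matrix (Fin g) (Fin g) ℂ}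
    (hΩ : Ω ∈ siegelUpperHalfSpace g) (m n : Fin g → ℤ) {v : Fin g → ℂ}
    (hv : theta α β v Ω ≠ 0) (w : Fin g → ℂ) :
    fderiv ℂ (fun v ↦ theta α β v Ω)
        (v + ((fun i ↦ (m i : ℂ)) + Ω *ᵥ fun i ↦ (n i : ℂ))) w /
      theta α β (v + ((fun i ↦ (m i : ℂ)) + Ω *ᵥ fun i ↦ (n i : ℂ))) Ω =
    fderiv ℂ (fun v ↦ theta α β v Ω) v w / theta α β v Ω -
      2 * Real.pi * I * ((fun i ↦ (n i : ℂ)) ⬝ᵥ w) := by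
  have h1 := (hasFDerivAt_thetaFactor (α := α) β Ω m n v).mul
    (differentiable_theta (α := α) β hΩ.2 v).hasFDerivAt
  have h2 : (fun v ↦ theta α β (v + ((fun i ↦ (m i : ℂ)) + Ω *ᵥ fun i ↦ (n i : ℂ))) Ω) =
      thetaFactor α β Ω m n * fun v ↦ theta α β v Ω :=
    funext fun v ↦ theta_add_lattice α β hΩ.1 m n v
  rw [← fderiv_comp_add_right, h2, h1.fderiv, theta_add_lattice α β hΩ.1]
  simp only [add_apply, smul_apply,
    neg_apply, smul_eq_mul, thetaForm_zero_apply]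
  have := thetaFactor_ne_zero (α := α) β Ω m n v
  field_simp
  ring

theorem isUnit_det_of_posDef {Y : Matrix (Fin g) (Fin g) ℝ} (hY : Y.PosDef) : IsUnit Y.det :=
  (Matrix.isUnit_iff_isUnit_det _).mp hY.isUnit

theorem map_ofReal_mul_map_inv {Y : Matrix (Fin g) (Fin g) ℝ} (hY : Y.PosDef) :
    Y.map Complex.ofReal * Y⁻¹.map Complex.ofReal = 1 := by
  have := congrArg (fun M ↦ M.map Complex.ofRealHom)
    (Matrix.mul_nonsing_inv Y (isUnit_det_of_posDef hY))
  rw [Matrix.map_mul, Matrix.map_one _ (map_zero _) (map_one _)] at this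
  exact this

theorem zetaHat_add_lattice (hω : IsUnit ω.det) (hΩ : ω⁻¹ * ω' ∈ siegelUpperHalfSpace g)
    {l : Fin g → ℂ} (hl : l ∈ latticeOf ω ω') {u : Fin g → ℂ}
    (hu : sigma ω ω' η α β u ≠ 0) :
    sigma ω ω' η α β (u + l) ≠ 0 ∧
      zetaHat ω ω' η α β (u + l) = zetaHat ω ω' η α β u := by
  obtain ⟨m, n, rfl⟩ := hl
  have hv : ω⁻¹ *ᵥ (u + (ω *ᵥ (fun i ↦ (m i : ℂ)) + ω' *ᵥ (fun i ↦ (n i : ℂ)))) =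
      ω⁻¹ *ᵥ u + ((fun i ↦ (m i : ℂ)) + (ω⁻¹ * ω') *ᵥ fun i ↦ (n i : ℂ)) := by
    rw [Matrix.mulVec_add, Matrix.mulVec_add, Matrix.mulVec_mulVec, Matrix.mulVec_mulVec,
      Matrix.nonsing_inv_mul _ hω, Matrix.one_mulVec]
  rw [sigma_ne_zero_iff] at hu ⊢
  have hne : theta α β
      (ω⁻¹ *ᵥ (u + (ω *ᵥ (fun i ↦ (m i : ℂ)) + ω' *ᵥ (fun i ↦ (n i : ℂ))))) (ω⁻¹ * ω') ≠ 0 := by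
    rw [hv, theta_add_lattice α β hΩ.1]
    exact mul_ne_zero (thetaFactor_ne_zero β _ m n _) hu
  refine ⟨hne, ?_⟩
  funext i
  rw [zetaHat_apply η β hΩ.2 hne, zetaHat_apply η β hΩ.2 hu, hv,
    logDeriv_theta_add_lattice β hΩ m n hu]
  set Ω := ω⁻¹ * ω' with hΩdef
  -- m is real, so only Im(Ω)n is added; symmetry of Ω turns it into the row vector nᵗʳ Im(Ω), which
  -- Im(Ω)⁻¹ then cancels.
  have him : (fun i ↦ (((ω⁻¹ *ᵥ u + ((fun i ↦ (m i : ℂ)) + Ω *ᵥ fun i ↦ (n i : ℂ))) i).im : ℂ)) =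
      (fun i ↦ (((ω⁻¹ *ᵥ u) i).im : ℂ)) +
        (fun i ↦ (n i : ℂ)) ᵥ* (imMat Ω).map Complex.ofReal := by
    funext i
    have hs : ∀ j, Ω j i = Ω i j := fun j ↦ congrFun (congrFun hΩ.1 i) j
    simp only [Pi.add_apply, Complex.add_im, Complex.intCast_im, zero_add, Complex.ofReal_add]
    congr 1
    simp [Matrix.mulVec, Matrix.vecMul, dotProduct, imMat, hs, mul_comm]
  rw [him, Matrix.add_vecMul, Matrix.vecMul_vecMul, ← Matrix.mul_assoc,
    map_ofReal_mul_map_inv hΩ.2, one_mul, Pi.add_apply]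
  have : (fun i ↦ (n i : ℂ)) ⬝ᵥ (ω⁻¹ *ᵥ Pi.single i 1) = ((fun i ↦ (n i : ℂ)) ᵥ* ω⁻¹) i := by
    rw [Matrix.dotProduct_mulVec, dotProduct_single, mul_one]
  rw [this]
  ring

end ZetaFunction

/-! ### The matrix `P` -/

/-- For x = a + ib the cross terms cancel by symmetry, leaving aᵗʳYa + bᵗʳYb. -/
theorem posDef_map_ofReal {g : ℕ} {Y : Matrix (Fin g) (Fin g) ℝ} (hY : Y.PosDef) :
    (Y.map Complex.ofReal).PosDef := by
  have hs : ∀ i j, Y j i = Y i j := fun i j ↦ by simpa using hY.isHermitian.apply i j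
  refine Matrix.PosDef.of_dotProduct_mulVec_pos ?_ fun x hx ↦ ?_
  · ext i j
    simp [hs]
  · set a : Fin g → ℝ := fun i ↦ (x i).re with ha
    set b : Fin g → ℝ := fun i ↦ (x i).im with hb
    have hsymm : b ⬝ᵥ (Y *ᵥ a) = a ⬝ᵥ (Y *ᵥ b) := by
      rw [Matrix.dotProduct_mulVec, ← Matrix.mulVec_transpose, dotProduct_comm]
      congr 2
      ext i j
      exact hs i j
    have hx' : x = (fun i ↦ (a i : ℂ)) + I • fun i ↦ (b i : ℂ) := by
      funext i
      simp [ha, hb, mul_comm I, Complex.re_add_im]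
    have hstar : star x = (fun i ↦ (a i : ℂ)) - I • fun i ↦ (b i : ℂ) := by
      funext i
      apply Complex.ext <;> simp [ha, hb]
    have hr : ∀ c d : Fin g → ℝ, (fun i ↦ (c i : ℂ)) ⬝ᵥ
        (Y.map Complex.ofReal *ᵥ fun i ↦ (d i : ℂ)) = ((c ⬝ᵥ (Y *ᵥ d) : ℝ) : ℂ) := fun c d ↦ by
      simp [dotProduct, Matrix.mulVec]
    have hval : star x ⬝ᵥ (Y.map Complex.ofReal *ᵥ x) =
        ((a ⬝ᵥ (Y *ᵥ a) + b ⬝ᵥ (Y *ᵥ b) : ℝ) : ℂ) := by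
      rw [hstar]
      conv_lhs => rw [hx']
      simp only [Matrix.mulVec_add, Matrix.mulVec_smul, sub_dotProduct, dotProduct_add,
        smul_dotProduct, dotProduct_smul, hr, hsymm, smul_eq_mul, Complex.ofReal_add]
      linear_combination (-((b ⬝ᵥ (Y *ᵥ b) : ℝ) : ℂ)) * Complex.I_sq
    rw [hval, Complex.zero_lt_real]
    have hnn : ∀ c : Fin g → ℝ, 0 ≤ c ⬝ᵥ (Y *ᵥ c) := fun c ↦ by
      simpa using hY.posSemidef.dotProduct_mulVec_nonneg c
    have hpos : ∀ c : Fin g → ℝ, c ≠ 0 → 0 < c ⬝ᵥ (Y *ᵥ c) := fun c hc ↦ by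
      simpa using hY.dotProduct_mulVec_pos hc
    by_cases ha0 : a = 0
    · have hb0 : b ≠ 0 := fun hb0 ↦ hx (by rw [hx', ha0, hb0]; ext; simp)
      linarith [hnn a, hpos b hb0]
    · linarith [hnn b, hpos a ha0]

section PeriodMatrix

variable {g : ℕ} {ω ω' : Matrix (Fin g) (Fin g) ℂ}

/-- Substitute ω' = ωΩ and use Ω - Ω̄ = 2i Im Ω. -/
theorem periodP_eq (hω : IsUnit ω.det) (hΩ : (ω⁻¹ * ω')ᵀ = ω⁻¹ * ω') :
    periodP ω ω' = ω.map conj * (imMat (ω⁻¹ * ω')).map Complex.ofReal * ωᵀ := by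
  have h1 : ω' = ω * (ω⁻¹ * ω') := by
    rw [← Matrix.mul_assoc, Matrix.mul_nonsing_inv _ hω, one_mul]
  set Ω := ω⁻¹ * ω' with hΩdef
  have h2 : ω'ᵀ = Ω * ωᵀ := by
    conv_lhs => rw [h1]
    rw [Matrix.transpose_mul, hΩ]
  have h3 : ω'.map conj = ω.map conj * Ω.map conj := by
    conv_lhs => rw [h1]
    exact Matrix.map_mul (f := starRingEnd ℂ)
  have h4 : (imMat Ω).map Complex.ofReal = (1 / (2 * I) : ℂ) • (Ω - Ω.map conj) := by
    ext i j
    simp only [imMat, Matrix.map_apply, Matrix.smul_apply, Matrix.sub_apply, smul_eq_mul,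
      Complex.sub_conj]
    field_simp [Complex.I_ne_zero]
    push_cast
    ring
  rw [periodP, h2, h3, h4, Matrix.mul_smul, Matrix.smul_mul, Matrix.mul_sub, Matrix.sub_mul,
    Matrix.mul_assoc (ω.map conj) Ω]

theorem posDef_periodP (hω : IsUnit ω.det) (hΩ : ω⁻¹ * ω' ∈ siegelUpperHalfSpace g) :
    (periodP ω ω').PosDef := by
  have h : ωᵀ = (ω.map conj)ᴴ := by
    ext i j
    simp
  rw [periodP_eq hω hΩ.1, h]
  refine (posDef_map_ofReal hΩ.2).mul_mul_conjTranspose_same ?_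
  rw [Matrix.vecMul_injective_iff_isUnit, Matrix.isUnit_iff_isUnit_det]
  have : (ω.map conj).det = conj ω.det := ((starRingEnd ℂ).map_det ω).symm
  rw [this]
  exact hω.map (starRingEnd ℂ)

/-- The inverse is grouped so that its right factor is the conjugated coefficient matrix occurring
in `exists_zetaHat_eq_add_conj`. -/
theorem inv_periodP (hω : IsUnit ω.det) (hΩ : ω⁻¹ * ω' ∈ siegelUpperHalfSpace g) :
    (periodP ω ω')⁻¹ =
      (ω⁻¹)ᵀ * ((imMat (ω⁻¹ * ω'))⁻¹.map Complex.ofReal * ω⁻¹).map conj := by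
  refine Matrix.inv_eq_right_inv ?_
  have h1 : ω.map conj * ω⁻¹.map conj = 1 := by
    have := congrArg (fun M ↦ M.map (starRingEnd ℂ)) (Matrix.mul_nonsing_inv ω hω)
    simpa only [Matrix.map_mul, Matrix.map_one _ (map_zero _) (map_one _)] using this
  have h2 : ωᵀ * (ω⁻¹)ᵀ = 1 := by
    rw [← Matrix.transpose_mul, Matrix.nonsing_inv_mul _ hω, Matrix.transpose_one]
  have h3 : ((imMat (ω⁻¹ * ω'))⁻¹.map Complex.ofReal * ω⁻¹).map conj =
      (imMat (ω⁻¹ * ω'))⁻¹.map Complex.ofReal * ω⁻¹.map conj := by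
    rw [Matrix.map_mul (f := starRingEnd ℂ)]
    congr 1
    ext i j
    simp
  rw [periodP_eq hω hΩ.1, h3, Matrix.mul_assoc, ← Matrix.mul_assoc ωᵀ, h2, one_mul,
    Matrix.mul_assoc, ← Matrix.mul_assoc ((imMat _).map _), map_ofReal_mul_map_inv hΩ.2, one_mul,
    h1]

end PeriodMatrix

/-! ### Sums of holomorphic and antiholomorphic functions -/

section Harmonic

variable {U : Set ℂ} {G H K : ℂ → ℂ}

theorem contDiffAt_add_conj (hU : IsOpen U) (hH : DifferentiableOn ℂ H U)
    (hK : DifferentiableOn ℂ K U) (hG : ∀ z ∈ U, G z = H z + conj (K z)) {z : ℂ} (hz : z ∈ U) :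
    ContDiffAt ℝ (⊤ : ℕ∞) G z := by
  have h : ∀ {L : ℂ → ℂ}, DifferentiableOn ℂ L U → ContDiffAt ℝ (⊤ : ℕ∞) L z := fun hL ↦
    ((hL.contDiffOn hU).contDiffAt (hU.mem_nhds hz)).restrict_scalars ℝ
  refine ((h hH).add (Complex.conjCLE.contDiff.contDiffAt.comp z (h hK))).congr_of_eventuallyEq ?_
  filter_upwards [hU.mem_nhds hz] with w hw
  exact hG w hw

theorem fderiv_add_conj (hU : IsOpen U) (hH : DifferentiableOn ℂ H U)
    (hK : DifferentiableOn ℂ K U) (hG : ∀ z ∈ U, G z = H z + conj (K z)) {z : ℂ} (hz : z ∈ U)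
    (w : ℂ) : fderiv ℝ G z w = deriv H z * w + conj (deriv K z * w) := by
  have h : ∀ {L : ℂ → ℂ}, DifferentiableOn ℂ L U →
      HasFDerivAt L ((ContinuousLinearMap.toSpanSingleton ℂ (deriv L z)).restrictScalars ℝ) z :=
    fun hL ↦ (hL.differentiableAt (hU.mem_nhds hz)).hasDerivAt.hasFDerivAt.restrictScalars ℝ
  have h1 := (h hH).add (Complex.conjCLE.hasFDerivAt.comp z (h hK))
  have h2 : G =ᶠ[𝓝 z] H + (Complex.conjCLE ∘ K) := by
    filter_upwards [hU.mem_nhds hz] with w hw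
    exact hG w hw
  rw [(h1.congr_of_eventuallyEq h2).fderiv]
  simp [mul_comm]

theorem partialX_add_conj (hU : IsOpen U) (hH : DifferentiableOn ℂ H U)
    (hK : DifferentiableOn ℂ K U) (hG : ∀ z ∈ U, G z = H z + conj (K z)) {z : ℂ} (hz : z ∈ U) :
    partialX G z = deriv H z + conj (deriv K z) := by
  simp [partialX, fderiv_add_conj hU hH hK hG hz]

theorem partialY_add_conj (hU : IsOpen U) (hH : DifferentiableOn ℂ H U)
    (hK : DifferentiableOn ℂ K U) (hG : ∀ z ∈ U, G z = H z + conj (K z)) {z : ℂ} (hz : z ∈ U) :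
    partialY G z = I * deriv H z + conj (I * deriv K z) := by
  simp [partialY, fderiv_add_conj hU hH hK hG hz, mul_comm]

/-- Both ∂/∂x and ∂/∂y preserve the shape H + K̄, replacing (H, K) by (H′, K′) and (iH′, iK′);
applied twice, they cancel because i² = -1. -/
theorem laplacian_add_conj (hU : IsOpen U) (hH : DifferentiableOn ℂ H U)
    (hK : DifferentiableOn ℂ K U) (hG : ∀ z ∈ U, G z = H z + conj (K z)) {z : ℂ} (hz : z ∈ U) :
    partialX (partialX G) z + partialY (partialY G) z = 0 := by
  have hH' := hH.deriv hU
  have hK' := hK.deriv hU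
  rw [partialX_add_conj hU hH' hK' (fun w hw ↦ partialX_add_conj hU hH hK hG hw) hz,
    partialY_add_conj hU (hH'.const_mul I) (hK'.const_mul I)
      (fun w hw ↦ partialY_add_conj hU hH hK hG hw) hz,
    deriv_const_mul _ (hH'.differentiableAt (hU.mem_nhds hz)),
    deriv_const_mul _ (hK'.differentiableAt (hU.mem_nhds hz))]
  simp only [map_mul, Complex.conj_I]
  linear_combination (deriv (deriv H) z + conj (deriv (deriv K) z)) * Complex.I_sq

theorem wirtinger_add_conj (hU : IsOpen U) (hH : DifferentiableOn ℂ H U)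
    (hK : DifferentiableOn ℂ K U) (hG : ∀ z ∈ U, G z = H z + conj (K z)) {z : ℂ} (hz : z ∈ U) :
    1 / 2 * (partialX G z + I * partialY G z) = conj (deriv K z) := by
  rw [partialX_add_conj hU hH hK hG hz, partialY_add_conj hU hH hK hG hz]
  simp only [map_mul, Complex.conj_I]
  linear_combination (1 / 2 * (deriv H z - conj (deriv K z))) * Complex.I_sq

end Harmonic

/-! ### The completed zeta function along the Eichler integrals -/

section Composite

variable {N r : ℕ} (F : Fin r → S2 N) {ω ω' : Matrix (Fin r) (Fin r) ℂ}
  (η : Matrix (Fin r) (Fin r) ℂ) (α β : Fin r → ℝ)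

/-- The points of the upper half-plane at which `σ` does not vanish on the Eichler integrals. -/
def regularLocus (ω ω' η : Matrix (Fin r) (Fin r) ℂ) : Set ℂ :=
  {z | 0 < z.im ∧ sigma ω ω' η α β (eichlerIntegral F (ofComplex z)) ≠ 0}

theorem differentiableAt_eichlerIntegral {z : ℂ} (hz : 0 < z.im) :
    DifferentiableAt ℂ (fun z ↦ eichlerIntegral F (ofComplex z)) z :=
  differentiableAt_pi.mpr fun j ↦ (hasDerivAt_eichlerIntegral F j hz).differentiableAt

theorem isOpen_regularLocus (hΩ : (imMat (ω⁻¹ * ω')).PosDef) :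
    IsOpen (regularLocus F α β ω ω' η) := by
  have hc : ContinuousOn (fun z ↦ sigma ω ω' η α β (eichlerIntegral F (ofComplex z)))
      {z : ℂ | 0 < z.im} := fun z hz ↦
    ((differentiable_sigma η β hΩ).continuous.continuousAt.comp
      (differentiableAt_eichlerIntegral F hz).continuousAt).continuousWithinAt
  exact hc.isOpen_inter_preimage isOpen_upperHalfPlaneSet isOpen_compl_singleton

theorem hasDerivAt_normalizedEichler (ω : Matrix (Fin r) (Fin r) ℂ) (k : Fin r) {z : ℂ}
    (hz : 0 < z.im) :
    HasDerivAt (fun z ↦ (ω⁻¹ *ᵥ eichlerIntegral F (ofComplex z)) k)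
      (2 * Real.pi * I * (ω⁻¹ *ᵥ fun j ↦ F j (ofComplex z)) k) z := by
  have h := HasDerivAt.fun_sum (u := Finset.univ) fun j _ ↦
    (hasDerivAt_eichlerIntegral F j hz).const_mul (ω⁻¹ k j)
  refine h.congr_deriv ?_
  simp only [Matrix.mulVec, dotProduct, Finset.mul_sum]
  exact Finset.sum_congr rfl fun j _ ↦ by ring

/-- On the regular locus each component of the completed zeta function is the sum of a holomorphic
function and of the conjugate of a linear combination of Eichler integrals. -/
theorem exists_zetaHat_eq_add_conj (hΩ : (imMat (ω⁻¹ * ω')).PosDef) (i : Fin r) :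
    ∃ H K : ℂ → ℂ, DifferentiableOn ℂ H (regularLocus F α β ω ω' η) ∧
      DifferentiableOn ℂ K (regularLocus F α β ω ω' η) ∧
      (∀ z ∈ regularLocus F α β ω ω' η,
        ((fun z : ℍ ↦ zetaHat ω ω' η α β (eichlerIntegral F z) i) ∘ ofComplex) z =
          H z + conj (K z)) ∧
      ∀ z ∈ regularLocus F α β ω ω' η, 2 * I * deriv K z = 4 * (Real.pi : ℂ) ^ 2 *
        ((ω⁻¹ *ᵥ fun j ↦ F j (ofComplex z)) ᵥ*
          ((imMat (ω⁻¹ * ω'))⁻¹.map Complex.ofReal * ω⁻¹).map conj) i := by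
  set M := (imMat (ω⁻¹ * ω'))⁻¹.map Complex.ofReal * ω⁻¹ with hM
  set V : ℂ → Fin r → ℂ := fun z ↦ ω⁻¹ *ᵥ eichlerIntegral F (ofComplex z) with hV
  have hVd : ∀ k, ∀ z ∈ regularLocus F α β ω ω' η, HasDerivAt (fun z ↦ V z k)
      (2 * Real.pi * I * (ω⁻¹ *ᵥ fun j ↦ F j (ofComplex z)) k) z := fun k z hz ↦
    hasDerivAt_normalizedEichler F ω k hz.1
  have hVd' : ∀ z ∈ regularLocus F α β ω ω' η, DifferentiableAt ℂ V z := fun z hz ↦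
    differentiableAt_pi.mpr fun k ↦ (hVd k z hz).differentiableAt
  -- The nonholomorphic term is ∑ π M(v - v̄): the part with v joins H, and -πM v̄ is the conjugate
  -- of -π M̄ v.
  have hK : ∀ z ∈ regularLocus F α β ω ω' η,
      HasDerivAt (fun z ↦ ∑ k, -Real.pi * conj (M k i) * V z k)
      (∑ k, -Real.pi * conj (M k i) *
        (2 * Real.pi * I * (ω⁻¹ *ᵥ fun j ↦ F j (ofComplex z)) k)) z := fun z hz ↦
    HasDerivAt.fun_sum fun k _ ↦ (hVd k z hz).const_mul _
  refine ⟨fun z ↦ fderiv ℂ (fun v ↦ theta α β v (ω⁻¹ * ω')) (V z) (ω⁻¹ *ᵥ Pi.single i 1) /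
    theta α β (V z) (ω⁻¹ * ω') + ∑ k, Real.pi * M k i * V z k, _, fun z hz ↦ ?_,
    fun z hz ↦ (hK z hz).differentiableAt.differentiableWithinAt, fun z hz ↦ ?_, fun z hz ↦ ?_⟩
  · have h0 := (sigma_ne_zero_iff η β _).mp hz.2
    refine DifferentiableAt.differentiableWithinAt (DifferentiableAt.add
      (DifferentiableAt.div ?_ ?_ h0) (DifferentiableAt.fun_sum fun k _ ↦
        (hVd k z hz).differentiableAt.const_mul _))
    · exact (differentiable_fderiv_theta β hΩ _ _).comp z (hVd' z hz)
    · exact (differentiable_theta β hΩ _).comp z (hVd' z hz)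
  · rw [Function.comp_apply, zetaHat_apply η β hΩ ((sigma_ne_zero_iff η β _).mp hz.2), add_assoc]
    congr 1
    simp only [Matrix.vecMul, dotProduct]
    rw [map_sum, Finset.mul_sum, ← Finset.sum_add_distrib]
    refine Finset.sum_congr rfl fun k _ ↦ ?_
    have him : ((V z k).im : ℂ) * (2 * I) = V z k - conj (V z k) := by
      rw [Complex.sub_conj]; push_cast; ring
    simp only [map_mul, map_neg, Complex.conj_ofReal, Complex.conj_conj]
    linear_combination (Real.pi * M k i) * him
  -- The constant is 2i · (-π) · 2πi = 4π².
  · rw [(hK z hz).deriv, Matrix.vecMul, dotProduct, Finset.mul_sum, Finset.mul_sum]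
    refine Finset.sum_congr rfl fun k _ ↦ ?_
    simp only [Matrix.map_apply]
    linear_combination (-4 * (Real.pi : ℂ) ^ 2 * conj (M k i) *
      (ω⁻¹ *ᵥ fun j ↦ F j (ofComplex z)) k) * Complex.I_sq

end Composite

end Kleinian

theorem theorem1p1 {N r : ℕ} [NeZero N] [NeZero r]
    -- a newform and its Galois conjugates
    (f : S2 N) (hf : IsNewform f) (F : Fin r → S2 N) (hF : IsGaloisOrbit f F)
    -- period matrices of the period lattice
    (ω ω' : Matrix (Fin r) (Fin r) ℂ) (hω : IsUnit ω.det)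
    (hΛ : (periodLattice F : Set (Fin r → ℂ)) = latticeOf ω ω')
    (hΩ : ω⁻¹ * ω' ∈ siegelUpperHalfSpace r)
    -- the quasi-period matrix may be any matrix, and the characteristic any pair of real vectors
    (η : Matrix (Fin r) (Fin r) ℂ) (α β : Fin r → ℝ) :
    -- the Eichler integrals converge, the theta series converges, and `σ` is holomorphic
    (∀ (j : Fin r) (τ : ℍ), IntegrableOn (eichlerIntegrand (F j) τ) (Set.Ioi (0 : ℝ))) ∧
    (∀ u : Fin r → ℂ, Summable (thetaTerm α β (ω⁻¹ *ᵥ u) (ω⁻¹ * ω'))) ∧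
    Differentiable ℂ (sigma ω ω' η α β) ∧
    -- `ζ = ∇ log σ` is defined near the values of the Eichler integrals where `σ` is not zero
    (∀ τ : ℍ, sigma ω ω' η α β (eichlerIntegral F τ) ≠ 0 →
      ∃ L : (Fin r → ℂ) → ℂ, ∀ᶠ v in 𝓝 (eichlerIntegral F τ),
        DifferentiableAt ℂ L v ∧ cexp (L v) = sigma ω ω' η α β v ∧
        ∀ i, fderiv ℂ L v (Pi.single i 1) = zeta ω ω' η α β v i) ∧
    -- invariance
    (∀ γ ∈ Gamma0 N, ∀ τ : ℍ, sigma ω ω' η α β (eichlerIntegral F τ) ≠ 0 →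
      sigma ω ω' η α β (eichlerIntegral F (γ • τ)) ≠ 0 ∧
      zetaHat ω ω' η α β (eichlerIntegral F (γ • τ)) =
        zetaHat ω ω' η α β (eichlerIntegral F τ)) ∧
    -- smoothness and harmonicity
    (∀ τ : ℍ, sigma ω ω' η α β (eichlerIntegral F τ) ≠ 0 → ∀ i : Fin r,
      ContDiffAt ℝ (⊤ : ℕ∞)
        ((fun z : ℍ ↦ zetaHat ω ω' η α β (eichlerIntegral F z) i) ∘ ofComplex) (τ : ℂ) ∧
      hyperbolicLaplacian 0 (fun z : ℍ ↦ zetaHat ω ω' η α β (eichlerIntegral F z) i) τ = 0) ∧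
    -- the matrix `P` and the image under `ξ₀`
    (periodP ω ω').PosDef ∧
    (∀ τ : ℍ, sigma ω ω' η α β (eichlerIntegral F τ) ≠ 0 → ∀ i : Fin r,
      xi 0 (fun z : ℍ ↦ zetaHat ω ω' η α β (eichlerIntegral F z) i) τ =
        4 * (Real.pi : ℂ) ^ 2 * ((fun j ↦ F j τ) ᵥ* (periodP ω ω')⁻¹) i) := by
  have hlocus : ∀ τ : ℍ, sigma ω ω' η α β (eichlerIntegral F τ) ≠ 0 →
      (τ : ℂ) ∈ regularLocus F α β ω ω' η := fun τ h ↦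
    ⟨τ.im_pos, by rwa [ofComplex_apply]⟩
  have hopen := isOpen_regularLocus F η α β hΩ.2
  refine ⟨fun j τ ↦ integrableOn_eichlerIntegrand (F j) τ,
    fun u ↦ summable_thetaTerm β hΩ.2 _, differentiable_sigma η β hΩ.2,
    fun τ hτ ↦ exists_log_sigma η β hΩ.2 hτ, fun γ hγ τ hτ ↦ ?_, fun τ hτ i ↦ ?_,
    posDef_periodP hω hΩ, fun τ hτ i ↦ ?_⟩
  -- This is where the hypothesis that ω and ω' span the period lattice enters.
  · have hmem : eichlerIntegral F (γ • τ) - eichlerIntegral F τ ∈ latticeOf ω ω' :=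
      hΛ ▸ eichlerIntegral_smul_sub_mem F hγ τ
    simpa using zetaHat_add_lattice η β hω hΩ hmem hτ
  · obtain ⟨H, K, hH, hK, hG, -⟩ := exists_zetaHat_eq_add_conj F η α β hΩ.2 i
    refine ⟨contDiffAt_add_conj hopen hH hK hG (hlocus τ hτ), ?_⟩
    rw [hyperbolicLaplacian, laplacian_add_conj hopen hH hK hG (hlocus τ hτ)]
    simp
  · obtain ⟨H, K, hH, hK, hG, hK'⟩ := exists_zetaHat_eq_add_conj F η α β hΩ.2 i
    have h := hK' τ (hlocus τ hτ)
    rw [ofComplex_apply] at h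
    rw [xi, dbar, wirtinger_add_conj hopen hH hK hG (hlocus τ hτ), Complex.conj_conj, zpow_zero,
      mul_one, h, inv_periodP hω hΩ, ← Matrix.vecMul_vecMul, Matrix.vecMul_transpose]
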